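/- Let $n$ be a positive integer and let $\mathcal{G}_n=\{(x,y)\mid x,y\in\mathbb{R}^n\}$, a group under addition with the usual topology of $\mathbb{R}^{2n}$. Let $\mathbb{C}*\mathcal{G}_n$ be the twisted group ring, that is, the $\mathbb{C}$-algebra with basis $\{\bar g\mid g\in\mathcal{G}_n\}$ and multiplication determined by $\overline{(a,b)}\;\overline{(x,y)}=e^{2\pi i\,a\cdot y}\,\overline{(a+x,\,b+y)}$, where $\cdot$ is the dot product of $\mathbb{R}^n$. It acts on $L^2(\mathbb{R}^n)$ (complex-valued square-integrable functions modulo almost everywhere equality) by bounded operators, through the $\mathbb{C}$-linear extension of $\bigl(\overline{(x,y)}f\bigr)(t)=e^{2\pi i\,y\cdot t}f(t+x)$. For a subgroup $G\le\mathcal{G}_n$ let $\mathbb{C}*G$ be the subalgebra of $\mathbb{C}*\mathcal{G}_n$ with basis $\{\bar g\mid g\in G\}$. **Theorem.** Let $G$ be a discrete subgroup of $\mathcal{G}_n$. If $0\ne\theta\in\mathbb{C}*G$ and $0\ne f\in L^2(\mathbb{R}^n)$, then $\theta f\ne 0$. -/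

import Mathlib

open MeasureTheory

noncomputable section

/-- The abelian group `𝒢_n = {(x, y) | x, y ∈ ℝⁿ}` under addition, with the topology of `ℝ²ⁿ`. -/
abbrev TFGroup (n : ℕ) : Type :=
  EuclideanSpace ℝ (Fin n) × EuclideanSpace ℝ (Fin n)

/-- The Hilbert space `L²(ℝⁿ)` of complex-valued functions modulo almost everywhere equality. -/
abbrev L2Space (n : ℕ) : Type :=
  Lp ℂ 2 (volume : Measure (EuclideanSpace ℝ (Fin n)))

/-- `phase s = e^{2πis}`. -/
def phase (s : ℝ) : ℂ := Complex.exp (2 * Real.pi * Complex.I * s)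

theorem phase_zero : phase 0 = 1 := by simp [phase]

theorem phase_add (s t : ℝ) : phase (s + t) = phase s * phase t := by
  simp only [phase, ← Complex.exp_add]
  congr 1
  push_cast
  ring

theorem norm_phase (s : ℝ) : ‖phase s‖ = 1 := by
  have h : (2 * Real.pi * Complex.I * s : ℂ) = ((2 * Real.pi * s : ℝ) : ℂ) * Complex.I := by
    push_cast
    ring
  rw [phase, h, Complex.norm_exp_ofReal_mul_I]

theorem continuous_phase : Continuous phase := by
  unfold phase
  fun_prop

/-- The underlying vector space of the twisted group ring `ℂ*𝒢_n`: finite formal complex linear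
combinations of elements of `𝒢_n`. -/
def TwistedGroupRing (n : ℕ) : Type := TFGroup n →₀ ℂ

namespace TwistedGroupRing

variable {n : ℕ}

instance : AddCommGroup (TwistedGroupRing n) := inferInstanceAs (AddCommGroup (TFGroup n →₀ ℂ))

instance : Module ℂ (TwistedGroupRing n) := inferInstanceAs (Module ℂ (TFGroup n →₀ ℂ))

/-- The basis element `ḡ` of `ℂ*𝒢_n`. -/
def bar (g : TFGroup n) : TwistedGroupRing n := Finsupp.single g 1

/-- The linear map on `ℂ*𝒢_n` that sends each basis element `ḡ` to `v g`. -/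
def extend {M : Type*} [AddCommGroup M] [Module ℂ M] (v : TFGroup n → M) :
    TwistedGroupRing n →ₗ[ℂ] M :=
  Finsupp.linearCombination ℂ v

theorem extend_bar {M : Type*} [AddCommGroup M] [Module ℂ M] (v : TFGroup n → M)
    (g : TFGroup n) : extend v (bar g) = v g :=
  (Finsupp.linearCombination_single ℂ (1 : ℂ) g).trans (one_smul ℂ _)

theorem induction {p : TwistedGroupRing n → Prop} (hbar : ∀ g, p (bar g)) (hzero : p 0)
    (hadd : ∀ α β, p α → p β → p (α + β)) (hsmul : ∀ (c : ℂ) α, p α → p (c • α))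
    (α : TwistedGroupRing n) : p α := by
  refine Finsupp.induction_linear (motive := p) α hzero (fun _ _ => hadd _ _) fun g c => ?_
  have h : (Finsupp.single g c : TFGroup n →₀ ℂ) = c • Finsupp.single g 1 := by simp
  rw [h]
  exact hsmul c _ (hbar g)

/-- The bilinear multiplication of `ℂ*𝒢_n`, determined on basis elements by
`(a,b)‾ (x,y)‾ = e^{2πi a·y} (a+x, b+y)‾`. -/
def mulMap : TwistedGroupRing n →ₗ[ℂ] TwistedGroupRing n →ₗ[ℂ] TwistedGroupRing n :=
  extend fun g => extend fun h => phase (inner ℝ g.1 h.2) • bar (g + h)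

instance : Mul (TwistedGroupRing n) := ⟨fun α β => mulMap α β⟩

instance : One (TwistedGroupRing n) := ⟨bar 0⟩

theorem mul_def (α β : TwistedGroupRing n) : α * β = mulMap α β := rfl

theorem one_def : (1 : TwistedGroupRing n) = bar 0 := rfl

theorem bar_mul_bar (g h : TFGroup n) :
    bar g * bar h = phase (inner ℝ g.1 h.2) • bar (g + h) := by
  rw [mul_def, mulMap, extend_bar, extend_bar]

theorem mulMap_bar_bar (g h : TFGroup n) :
    mulMap (bar g) (bar h) = phase (inner ℝ g.1 h.2) • bar (g + h) := bar_mul_bar g h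

theorem mulMap_assoc (α β γ : TwistedGroupRing n) :
    mulMap (mulMap α β) γ = mulMap α (mulMap β γ) := by
  induction α using induction with
  | hzero => simp
  | hadd α α' h h' => simp [h, h']
  | hsmul c α h => simp [h]
  | hbar g =>
    induction β using induction with
    | hzero => simp
    | hadd β β' h h' => simp [h, h']
    | hsmul c β h => simp [h]
    | hbar h =>
      induction γ using induction with
      | hzero => simp
      | hadd γ γ' h h' => simp [h, h']
      | hsmul c γ h => simp [h]
      | hbar k =>
        simp only [mulMap_bar_bar, map_smul, LinearMap.smul_apply, smul_smul, ← phase_add,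
          Prod.fst_add, Prod.snd_add, inner_add_left, inner_add_right, add_assoc]
        congr 2
        ring

theorem one_mulMap (α : TwistedGroupRing n) : mulMap (bar 0) α = α := by
  induction α using induction with
  | hzero => simp
  | hadd α α' h h' => simp [h, h']
  | hsmul c α h => simp [h]
  | hbar g => simp [mulMap_bar_bar, phase_zero]

theorem mulMap_one (α : TwistedGroupRing n) : mulMap α (bar 0) = α := by
  induction α using induction with
  | hzero => simp
  | hadd α α' h h' => simp [h, h']
  | hsmul c α h => simp [h]
  | hbar g => simp [mulMap_bar_bar, phase_zero]

/-- The twisted group ring `ℂ*𝒢_n`. -/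
instance : Ring (TwistedGroupRing n) :=
  { (inferInstance : AddCommGroup (TwistedGroupRing n)),
    (inferInstance : Mul (TwistedGroupRing n)),
    (inferInstance : One (TwistedGroupRing n)) with
    mul_assoc := mulMap_assoc
    one_mul := one_mulMap
    mul_one := mulMap_one
    zero_mul := fun α => by simp [mul_def]
    mul_zero := fun α => by simp [mul_def]
    left_distrib := fun α β γ => by simp [mul_def]
    right_distrib := fun α β γ => by simp [mul_def] }

instance : Algebra ℂ (TwistedGroupRing n) :=
  Algebra.ofModule (fun c α β => by simp [mul_def]) (fun c α β => by simp [mul_def])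

/-- For a subgroup `G` of `𝒢_n`, the subalgebra `ℂ*G` of `ℂ*𝒢_n` with basis `{ḡ | g ∈ G}`. -/
def subgroupAlgebra (G : AddSubgroup (TFGroup n)) : Subalgebra ℂ (TwistedGroupRing n) :=
  (Submodule.span ℂ (bar '' (G : Set (TFGroup n)))).toSubalgebra
    (Submodule.subset_span ⟨0, G.zero_mem, rfl⟩) (by
      intro α β hα hβ
      induction hα using Submodule.span_induction with
      | zero => rw [zero_mul]; exact Submodule.zero_mem _
      | add α α' _ _ h h' => rw [add_mul]; exact Submodule.add_mem _ h h'
      | smul c α _ h => rw [smul_mul_assoc]; exact Submodule.smul_mem _ c h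
      | mem α h =>
        obtain ⟨g, hg, rfl⟩ := h
        induction hβ using Submodule.span_induction with
        | zero => rw [mul_zero]; exact Submodule.zero_mem _
        | add β β' _ _ h h' => rw [mul_add]; exact Submodule.add_mem _ h h'
        | smul c β _ h => rw [mul_smul_comm]; exact Submodule.smul_mem _ c h
        | mem β h =>
          obtain ⟨k, hk, rfl⟩ := h
          rw [bar_mul_bar]
          exact Submodule.smul_mem _ _ (Submodule.subset_span ⟨g + k, G.add_mem hg hk, rfl⟩))

end TwistedGroupRing

/-- The function `t ↦ e^{2πi y·t} f(t + x)`, for `g = (x, y)`. -/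
def shiftFun {n : ℕ} (g : TFGroup n) (f : EuclideanSpace ℝ (Fin n) → ℂ) :
    EuclideanSpace ℝ (Fin n) → ℂ :=
  fun t => phase (inner ℝ g.2 t) * f (t + g.1)

theorem shiftFun_congr {n : ℕ} (g : TFGroup n) {f f' : EuclideanSpace ℝ (Fin n) → ℂ}
    (h : f =ᵐ[volume] f') : shiftFun g f =ᵐ[volume] shiftFun g f' := by
  have h' := (measurePreserving_add_right volume g.1).quasiMeasurePreserving.ae_eq_comp h
  filter_upwards [h'] with t ht
  simp only [Function.comp_apply] at ht
  simp only [shiftFun, ht]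

theorem aestronglyMeasurable_shiftFun {n : ℕ} (g : TFGroup n)
    {f : EuclideanSpace ℝ (Fin n) → ℂ} (hf : AEStronglyMeasurable f volume) :
    AEStronglyMeasurable (shiftFun g f) volume := by
  have h1 : Continuous fun t : EuclideanSpace ℝ (Fin n) => phase (inner ℝ g.2 t) :=
    continuous_phase.comp (by fun_prop)
  exact h1.aestronglyMeasurable.mul
    (hf.comp_measurePreserving (measurePreserving_add_right volume g.1))

theorem eLpNorm_shiftFun {n : ℕ} (g : TFGroup n) {f : EuclideanSpace ℝ (Fin n) → ℂ}
    (hf : AEStronglyMeasurable f volume) :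
    eLpNorm (shiftFun g f) 2 volume = eLpNorm f 2 volume := by
  rw [← eLpNorm_comp_measurePreserving hf (measurePreserving_add_right volume g.1)]
  refine eLpNorm_congr_norm_ae (Filter.Eventually.of_forall fun t => ?_)
  simp [shiftFun, norm_phase]

theorem memLp_shiftFun {n : ℕ} (g : TFGroup n) {f : EuclideanSpace ℝ (Fin n) → ℂ}
    (hf : MemLp f 2 volume) : MemLp (shiftFun g f) 2 volume :=
  ⟨aestronglyMeasurable_shiftFun g hf.1, (eLpNorm_shiftFun g hf.1).trans_lt hf.2⟩

/-- The time-frequency shift by `g = (x, y)` as a bounded operator on `L²(ℝⁿ)`: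
`(x, y) f (t) = e^{2πi y·t} f(t + x)`. -/
def timeFreqShift {n : ℕ} (g : TFGroup n) : L2Space n →L[ℂ] L2Space n :=
  LinearMap.mkContinuous
    { toFun := fun f => (memLp_shiftFun g (Lp.memLp f)).toLp (shiftFun g f)
      map_add' := fun f f' => by
        rw [← MemLp.toLp_add, MemLp.toLp_eq_toLp_iff]
        refine (shiftFun_congr g (Lp.coeFn_add f f')).trans (Filter.Eventually.of_forall fun t => ?_)
        simp [shiftFun, mul_add]
      map_smul' := fun c f => by
        rw [RingHom.id_apply, ← MemLp.toLp_const_smul, MemLp.toLp_eq_toLp_iff]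
        refine (shiftFun_congr g (Lp.coeFn_smul c f)).trans (Filter.Eventually.of_forall fun t => ?_)
        simp [shiftFun, mul_left_comm] }
    1 fun f => by
      rw [one_mul, LinearMap.coe_mk, AddHom.coe_mk, Lp.norm_toLp,
        eLpNorm_shiftFun g (Lp.aestronglyMeasurable f), Lp.norm_def]

theorem coeFn_timeFreqShift {n : ℕ} (g : TFGroup n) (f : L2Space n) :
    timeFreqShift g f =ᵐ[volume] fun t => phase (inner ℝ g.2 t) * f (t + g.1) :=
  MemLp.coeFn_toLp (memLp_shiftFun g (Lp.memLp f))

theorem timeFreqShift_zero {n : ℕ} : timeFreqShift (0 : TFGroup n) = 1 := by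
  ext1 f
  refine Lp.ext ((coeFn_timeFreqShift 0 f).trans (Filter.Eventually.of_forall fun t => ?_))
  simp [phase_zero]

theorem timeFreqShift_mul {n : ℕ} (g h : TFGroup n) :
    timeFreqShift g * timeFreqShift h =
      phase (inner ℝ g.1 h.2) • timeFreqShift (g + h) := by
  ext1 f
  refine Lp.ext ?_
  rw [mul_apply_eq_comp, smul_apply]
  filter_upwards [coeFn_timeFreqShift g (timeFreqShift h f),
    shiftFun_congr g (coeFn_timeFreqShift h f), coeFn_timeFreqShift (g + h) f,
    Lp.coeFn_smul (phase (inner ℝ g.1 h.2)) (timeFreqShift (g + h) f)] with t h1 h2 h3 h4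
  simp only [shiftFun] at h2
  rw [h1, h2, h4, Pi.smul_apply, h3, smul_eq_mul, ← mul_assoc, ← mul_assoc, ← phase_add,
    ← phase_add, Prod.fst_add, Prod.snd_add, inner_add_left, inner_add_right,
    real_inner_comm g.1 h.2, add_assoc t g.1 h.1]
  congr 2
  ring

/-- The action of `ℂ*𝒢_n` on `L²(ℝⁿ)`: the algebra homomorphism `ℂ*𝒢_n → ℬ(L²(ℝⁿ))` that sends
each basis element `ḡ` to the time-frequency shift by `g`. -/
def twistedAction (n : ℕ) : TwistedGroupRing n →ₐ[ℂ] (L2Space n →L[ℂ] L2Space n) :=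
  AlgHom.ofLinearMap (TwistedGroupRing.extend timeFreqShift)
    (by rw [TwistedGroupRing.one_def, TwistedGroupRing.extend_bar, timeFreqShift_zero])
    (by
      intro α β
      induction α using TwistedGroupRing.induction with
      | hzero => simp
      | hadd α α' h h' => simp [add_mul, h, h']
      | hsmul c α h => simp [h]
      | hbar g =>
        induction β using TwistedGroupRing.induction with
        | hzero => simp
        | hadd β β' h h' => simp [mul_add, h, h']
        | hsmul c β h => simp [h]
        | hbar h =>
          rw [TwistedGroupRing.bar_mul_bar, map_smul, TwistedGroupRing.extend_bar,
            TwistedGroupRing.extend_bar, TwistedGroupRing.extend_bar, timeFreqShift_mul])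

end

/-!
The coefficients `F(h) = ⟪h̄ ψ, f⟫`, for a window `ψ ∈ L²(ℝⁿ)`, turn the action of `θ` on `f` into
twisted convolution (`inner_timeFreqShift_twistedAction`), so `θ f = 0` says that `θ * F = 0` for
the formal sum `F = ∑ F(h) h̄`. If `F` is square summable over `G` and `F ≠ 0`, this is impossible:
`G` is amenable and `ℂ*𝒢_n` is a domain. The details are as follows.

* Because `G` is discrete, there is a window `ψ` with `⟪ψ, f⟫ ≠ 0` for which the coefficients are
  square summable over `G` (`exists_window`). Indeed, for a window `φ` that is continuous with
  compact support, the function `V(x, y) = ⟪(x, y)‾ φ, f⟫` is a Fourier transform in `y`, so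
  Plancherel's formula and Tonelli's theorem give `V ∈ L²(ℝ²ⁿ)`. Hence `V` is square summable on
  almost every coset `G + z` with `z` small, and `ψ = z̄ φ` will do.

* Replacing `ψ` by its translate by `-k`, for `k ∈ G`, gives a solution `F_k` of `θ * F_k = 0` that
  is essentially `F` moved by `k`. For a finite `B ⊆ G` the restrictions of the `F_k`, `k ∈ B`,
  to `B` span a space of dimension at least `δ |B|`, where `δ = |F(0)|² / ‖F‖²`
  (`card_mul_le_finrank_mul`). Multiplication by `θ` maps this space to functions supported in a
  boundary of `B`, and it is injective since `ℂ*𝒢_n` has no zero divisors. So every such `B` has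
  a boundary of at least `δ |B|` points (`TwistedGroupRing.card_mul_le_card_convBoundary_mul`).

* Balls of `G` grow polynomially, so for some of them the boundary is smaller than that
  (`AddSubgroup.exists_card_convBoundary_lt`).
-/

noncomputable section

/-! ### The twisted group ring is a domain -/

namespace TwistedGroupRing

variable {n : ℕ}

/-- The coefficient of an element of `ℂ*𝒢_n` at the basis element `ḡ`. -/
def coeff (g : TFGroup n) : TwistedGroupRing n →ₗ[ℂ] ℂ := Finsupp.lapply g

/-- The finite set of `g` for which the coefficient at `ḡ` does not vanish. -/
def support (α : TwistedGroupRing n) : Finset (TFGroup n) := Finsupp.support α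

theorem mem_support {α : TwistedGroupRing n} {g : TFGroup n} :
    g ∈ α.support ↔ coeff g α ≠ 0 := Finsupp.mem_support_iff

theorem ext_coeff {α β : TwistedGroupRing n} (h : ∀ g, coeff g α = coeff g β) : α = β :=
  Finsupp.ext h

theorem support_nonempty {α : TwistedGroupRing n} (h : α ≠ 0) : α.support.Nonempty :=
  Finsupp.support_nonempty_iff.2 h

theorem coeff_bar (g h : TFGroup n) : coeff h (bar g) = if g = h then 1 else 0 := by
  classical
  exact Finsupp.single_apply

theorem extend_eq_sum {M : Type*} [AddCommGroup M] [Module ℂ M] (v : TFGroup n → M)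
    (α : TwistedGroupRing n) : extend v α = ∑ g ∈ α.support, coeff g α • v g := rfl

theorem eq_sum_coeff_smul_bar (α : TwistedGroupRing n) :
    α = ∑ g ∈ α.support, coeff g α • bar g := by
  refine ext_coeff fun h => ?_
  classical
  simp only [map_sum, map_smul, coeff_bar, smul_eq_mul, mul_ite, mul_one, mul_zero,
    Finset.sum_ite_eq']
  split_ifs with hh
  · rfl
  · simpa [mem_support] using hh

theorem coeff_bar_mul (g h : TFGroup n) (β : TwistedGroupRing n) :
    coeff h (bar g * β) = phase (inner ℝ g.1 (h - g).2) * coeff (h - g) β := by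
  induction β using induction with
  | hzero => simp
  | hadd β β' hβ hβ' => simp only [mul_add, map_add, hβ, hβ']
  | hsmul c β hβ =>
    simp only [mul_smul_comm, map_smul, hβ, smul_eq_mul]
    ring
  | hbar k =>
    rw [bar_mul_bar, map_smul, coeff_bar, coeff_bar, smul_eq_mul]
    by_cases hk : g + k = h
    · subst hk
      simp
    · rw [if_neg hk, if_neg (fun hk' => hk (by rw [hk']; abel))]
      simp

theorem coeff_mul (h : TFGroup n) (α β : TwistedGroupRing n) :
    coeff h (α * β) = ∑ g ∈ α.support,
      coeff g α * (phase (inner ℝ g.1 (h - g).2) * coeff (h - g) β) := by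
  conv_lhs => rw [eq_sum_coeff_smul_bar α]
  simp only [Finset.sum_mul, map_sum, smul_mul_assoc, map_smul, coeff_bar_mul, smul_eq_mul]

/-- `ℂ*𝒢_n` has no zero divisors: `𝒢_n` is a rational vector space, so some product of elements
of the two supports arises only once and hence is not cancelled. -/
theorem mul_ne_zero_of_ne_zero {α β : TwistedGroupRing n} (hα : α ≠ 0) (hβ : β ≠ 0) :
    α * β ≠ 0 := by
  let _ : Module ℚ (TFGroup n) := Module.compHom (TFGroup n) (algebraMap ℚ ℝ)
  obtain ⟨a, ha, b, hb, hu⟩ := UniqueSums.uniqueAdd_of_nonempty (support_nonempty hα)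
    (support_nonempty hβ)
  intro h0
  have h1 : coeff (a + b) (α * β) = coeff a α * (phase (inner ℝ a.1 b.2) * coeff b β) := by
    rw [coeff_mul, Finset.sum_eq_single_of_mem a ha]
    · simp
    · intro g hg hga
      by_cases hm : a + b - g ∈ β.support
      · exact absurd (hu hg hm (by abel)).1 hga
      · rw [mem_support, not_not] at hm
        simp [hm]
  have h2 : phase (inner ℝ a.1 b.2) ≠ 0 := by
    rw [← norm_ne_zero_iff, norm_phase]
    exact one_ne_zero
  rw [h0, map_zero] at h1
  exact mul_ne_zero (mem_support.1 ha) (mul_ne_zero h2 (mem_support.1 hb)) h1.symm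

theorem support_subset_of_mem_subgroupAlgebra {G : AddSubgroup (TFGroup n)}
    {α : TwistedGroupRing n} (hα : α ∈ subgroupAlgebra G) {g : TFGroup n} (hg : g ∈ α.support) :
    g ∈ G := by
  by_contra hgG
  rw [mem_support] at hg
  refine hg ?_
  have hle : Submodule.span ℂ (bar '' (G : Set (TFGroup n))) ≤ LinearMap.ker (coeff g) := by
    rw [Submodule.span_le]
    rintro _ ⟨k, hk, rfl⟩
    have hkg : k ≠ g := fun h => hgG (h ▸ hk)
    simp [coeff_bar, hkg]
  exact hle hα

end TwistedGroupRing

/-! ### Time-frequency shifts and twisted convolution -/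

theorem norm_timeFreqShift_apply {n : ℕ} (g : TFGroup n) (f : L2Space n) :
    ‖timeFreqShift g f‖ = ‖f‖ := by
  change ‖(memLp_shiftFun g (Lp.memLp f)).toLp (shiftFun g f)‖ = ‖f‖
  rw [Lp.norm_toLp, eLpNorm_shiftFun g (Lp.aestronglyMeasurable f), Lp.norm_def]

theorem inner_timeFreqShift_timeFreqShift {n : ℕ} (g : TFGroup n) (f f' : L2Space n) :
    inner ℂ (timeFreqShift g f) (timeFreqShift g f') = inner ℂ f f' :=
  LinearIsometry.inner_map_map
    (⟨(timeFreqShift g).toLinearMap, norm_timeFreqShift_apply g⟩ : L2Space n →ₗᵢ[ℂ] L2Space n) f f'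

theorem timeFreqShift_timeFreqShift {n : ℕ} (g h : TFGroup n) (f : L2Space n) :
    timeFreqShift g (timeFreqShift h f) =
      phase (inner ℝ g.1 h.2) • timeFreqShift (g + h) f := by
  rw [← smul_apply, ← timeFreqShift_mul, mul_apply_eq_comp]

theorem conj_phase_mul_phase (s : ℝ) : phase s * (starRingEnd ℂ) (phase s) = 1 := by
  rw [Complex.mul_conj, Complex.normSq_eq_norm_sq, norm_phase]
  simp

theorem twistedAction_apply {n : ℕ} (θ : TwistedGroupRing n) (f : L2Space n) :
    twistedAction n θ f = ∑ g ∈ θ.support, TwistedGroupRing.coeff g θ • timeFreqShift g f := by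
  change TwistedGroupRing.extend timeFreqShift θ f = _
  rw [TwistedGroupRing.extend_eq_sum, sum_apply]
  rfl

/-- The coefficients `h ↦ ⟪h̄ φ, f⟫` turn the action of `ℂ*𝒢_n` on `f` into twisted convolution. -/
theorem inner_timeFreqShift_twistedAction {n : ℕ} (θ : TwistedGroupRing n) (φ f : L2Space n)
    (h : TFGroup n) :
    inner ℂ (timeFreqShift h φ) (twistedAction n θ f) =
      ∑ g ∈ θ.support, TwistedGroupRing.coeff g θ *
        (phase (inner ℝ g.1 (h - g).2) * inner ℂ (timeFreqShift (h - g) φ) f) := by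
  rw [twistedAction_apply, inner_sum]
  refine Finset.sum_congr rfl fun g _ => ?_
  rw [inner_smul_right, ← inner_timeFreqShift_timeFreqShift g (timeFreqShift (h - g) φ) f,
    timeFreqShift_timeFreqShift, inner_smul_left, ← mul_assoc (phase _), conj_phase_mul_phase,
    one_mul, add_sub_cancel]

/-! ### Annihilated functions and boundaries of finite sets -/

/-- A subspace `W` of `ℂ^ι` that contains, for each `i`, a vector of square norm at most `M` whose
`i`-th entry has square modulus at least `c` has dimension at least `|ι| c / M`. -/
theorem card_mul_le_finrank_mul {ι : Type*} [Fintype ι] (W : Submodule ℂ (EuclideanSpace ℂ ι))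
    (w : ι → W) {c M : ℝ} (hc : ∀ i, c ≤ ‖(w i : EuclideanSpace ℂ ι) i‖ ^ 2)
    (hM : ∀ i, ‖w i‖ ^ 2 ≤ M) :
    Fintype.card ι * c ≤ Module.finrank ℂ W * M := by
  let e := stdOrthonormalBasis ℂ W
  have key (i : ι) : c ≤ (∑ j, ‖(e j : EuclideanSpace ℂ ι) i‖ ^ 2) * M := by
    have h1 : (w i : EuclideanSpace ℂ ι) i =
        ∑ j, inner ℂ (e j) (w i) * (e j : EuclideanSpace ℂ ι) i := by
      conv_lhs => rw [← e.sum_repr' (w i)]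
      simp
    have h2 : ‖(w i : EuclideanSpace ℂ ι) i‖ ≤
        ∑ j, ‖inner ℂ (e j) (w i)‖ * ‖(e j : EuclideanSpace ℂ ι) i‖ := by
      rw [h1]
      exact (norm_sum_le _ _).trans_eq (by simp)
    calc c ≤ ‖(w i : EuclideanSpace ℂ ι) i‖ ^ 2 := hc i
      _ ≤ (∑ j, ‖inner ℂ (e j) (w i)‖ * ‖(e j : EuclideanSpace ℂ ι) i‖) ^ 2 := by gcongr
      _ ≤ (∑ j, ‖inner ℂ (e j) (w i)‖ ^ 2) * ∑ j, ‖(e j : EuclideanSpace ℂ ι) i‖ ^ 2 :=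
        Finset.sum_mul_sq_le_sq_mul_sq _ _ _
      _ = ‖w i‖ ^ 2 * ∑ j, ‖(e j : EuclideanSpace ℂ ι) i‖ ^ 2 := by
        rw [e.sum_sq_norm_inner_right]
      _ ≤ M * ∑ j, ‖(e j : EuclideanSpace ℂ ι) i‖ ^ 2 := by
        gcongr
        exact hM i
      _ = _ := mul_comm _ _
  calc (Fintype.card ι : ℝ) * c = ∑ _i : ι, c := by simp
    _ ≤ ∑ i, (∑ j, ‖(e j : EuclideanSpace ℂ ι) i‖ ^ 2) * M := Finset.sum_le_sum fun i _ => key i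
    _ = (∑ j, ∑ i, ‖(e j : EuclideanSpace ℂ ι) i‖ ^ 2) * M := by
      rw [← Finset.sum_mul, Finset.sum_comm]
    _ = (∑ j, ‖e j‖ ^ 2) * M := by
      simp only [← EuclideanSpace.norm_sq_eq, Submodule.coe_norm]
    _ = Module.finrank ℂ W * M := by simp

open Classical in
/-- The points of `B + S` that have a translate by the negative of an element of `S` outside `B`:
if a function satisfies a convolution equation with kernel supported in `S`, then its restriction
to `B` satisfies that equation except at these points. -/
def convBoundary {A : Type*} [AddCommGroup A] (S B : Finset A) : Finset A :=
  (Finset.image₂ (· + ·) B S).filter fun h => ∃ s ∈ S, h - s ∉ B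

theorem mem_convBoundary {A : Type*} [AddCommGroup A] {S B : Finset A} {h : A} :
    h ∈ convBoundary S B ↔ (∃ b ∈ B, ∃ s ∈ S, b + s = h) ∧ ∃ s ∈ S, h - s ∉ B := by
  simp only [convBoundary, Finset.mem_filter, Finset.mem_image₂]

/-- Suppose that `θ ≠ 0` annihilates functions `u k`, for `k ∈ B`, that are concentrated near `k`
in the sense that `|u k k|² ≥ c`, while the sum of `|u k h|²` over `h ∈ B` is at most `M`.
Their restrictions to `B` span a space of
dimension at least `|B| c / M`, which multiplication by `θ` embeds into the functions on the
boundary of `B`. -/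
theorem TwistedGroupRing.card_mul_le_card_convBoundary_mul {n : ℕ} {θ : TwistedGroupRing n}
    (hθ : θ ≠ 0) (u : TFGroup n → TFGroup n → ℂ)
    (hu : ∀ k h, ∑ g ∈ θ.support, coeff g θ * (phase (inner ℝ g.1 (h - g).2) * u k (h - g)) = 0)
    (B : Finset (TFGroup n)) {c M : ℝ} (hc : ∀ b ∈ B, c ≤ ‖u b b‖ ^ 2)
    (hM : ∀ b ∈ B, ∑ h ∈ B, ‖u b h‖ ^ 2 ≤ M) :
    B.card * c ≤ (convBoundary θ.support B).card * M := by
  classical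
  -- `v ↦ ∑ v_b b̄` identifies `ℂ^B` with the elements of `ℂ*𝒢_n` supported in `B`
  let E : EuclideanSpace ℂ B →ₗ[ℂ] TwistedGroupRing n :=
    Fintype.linearCombination ℂ (fun b : B => bar b.1) ∘ₗ
      (WithLp.linearEquiv 2 ℂ (B → ℂ)).toLinearMap
  have hE (v : EuclideanSpace ℂ B) (h : TFGroup n) :
      coeff h (E v) = if hh : h ∈ B then v ⟨h, hh⟩ else 0 := by
    have : E v = ∑ b : B, v b • bar b.1 := by
      simp [E, Fintype.linearCombination_apply]
    rw [this]
    simp only [map_sum, map_smul, coeff_bar, smul_eq_mul, mul_ite, mul_one, mul_zero]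
    split_ifs with hh
    · rw [Finset.sum_eq_single_of_mem ⟨h, hh⟩ (Finset.mem_univ _)]
      · simp
      · intro b _ hb
        rw [if_neg fun hbh => hb (Subtype.ext hbh)]
    · refine Finset.sum_eq_zero fun b _ => ?_
      rw [if_neg fun hbh : b.1 = h => hh (hbh ▸ b.2)]
  let r (k : TFGroup n) : EuclideanSpace ℂ B := WithLp.toLp 2 fun b : B => u k b.1
  let W : Submodule ℂ (EuclideanSpace ℂ B) := Submodule.span ℂ (Set.range r)
  let D := convBoundary θ.support B
  let T : W →ₗ[ℂ] (D → ℂ) :=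
    (LinearMap.pi fun d : D => coeff d.1) ∘ₗ (LinearMap.mulLeft ℂ θ) ∘ₗ E ∘ₗ W.subtype
  have hT_out (v : W) (h : TFGroup n) (hh : h ∉ D) : coeff h (θ * E v) = 0 := by
    have hle : W ≤ LinearMap.ker (coeff h ∘ₗ LinearMap.mulLeft ℂ θ ∘ₗ E) := by
      rw [Submodule.span_le]
      rintro _ ⟨k, rfl⟩
      simp only [SetLike.mem_coe, LinearMap.mem_ker, LinearMap.comp_apply,
        LinearMap.mulLeft_apply, coeff_mul, hE]
      by_cases hB : ∃ s ∈ θ.support, h - s ∈ B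
      · obtain ⟨s, hs, hsB⟩ := hB
        have hin : ∀ g ∈ θ.support, h - g ∈ B := by
          intro g hg
          by_contra hgB
          exact hh (mem_convBoundary.2 ⟨⟨h - s, hsB, s, hs, sub_add_cancel h s⟩, g, hg, hgB⟩)
        rw [← hu k h]
        refine Finset.sum_congr rfl fun g hg => ?_
        rw [dif_pos (hin g hg)]
      · push Not at hB
        refine Finset.sum_eq_zero fun g hg => ?_
        rw [dif_neg (hB g hg)]
        simp
    exact hle v.2
  have hT : Function.Injective T := by
    rw [← LinearMap.ker_eq_bot, LinearMap.ker_eq_bot']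
    intro v hv
    have h0 : θ * E v = 0 := by
      refine ext_coeff fun h => ?_
      rw [map_zero]
      by_cases hh : h ∈ D
      · exact congrFun hv ⟨h, hh⟩
      · exact hT_out v h hh
    have hEv : E v = 0 := by
      by_contra hne
      exact mul_ne_zero_of_ne_zero hθ hne h0
    refine Subtype.ext (PiLp.ext fun b => ?_)
    have := hE v b.1
    rw [hEv, map_zero, dif_pos b.2] at this
    exact this.symm
  have hdim : Module.finrank ℂ W ≤ D.card := by
    simpa using LinearMap.finrank_le_finrank_of_injective hT
  have hr (k : B) : ‖r k.1‖ ^ 2 ≤ M := by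
    rw [EuclideanSpace.norm_sq_eq]
    refine le_of_eq_of_le ?_ (hM k.1 k.2)
    exact Finset.sum_coe_sort B fun h => ‖u k.1 h‖ ^ 2
  have hmain := card_mul_le_finrank_mul W
    (fun b : B => ⟨r b.1, Submodule.subset_span ⟨b.1, rfl⟩⟩) (fun b => hc b.1 b.2) hr
  rw [Fintype.card_coe] at hmain
  rcases B.eq_empty_or_nonempty with rfl | ⟨b, hb⟩
  · simp [convBoundary]
  have hM0 : 0 ≤ M := (sq_nonneg _).trans (hr ⟨b, hb⟩)
  exact hmain.trans (by gcongr)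

/-! ### Growth of discrete subgroups -/

section Growth

variable {V : Type*} [NormedAddCommGroup V]

theorem AddSubgroup.exists_forall_norm_lt_imp_eq_zero (G : AddSubgroup V) [DiscreteTopology G] :
    ∃ r > 0, ∀ g ∈ G, ‖g‖ < r → g = 0 := by
  obtain ⟨r, hr, h⟩ := Metric.isOpen_singleton_iff.1 (isOpen_discrete {(0 : G)})
  refine ⟨r, hr, fun g hg hgr => ?_⟩
  have := h ⟨g, hg⟩ (by simpa [dist_eq_norm] using hgr)
  exact congrArg Subtype.val this

theorem AddSubgroup.finite_inter_closedBall [ProperSpace V] (G : AddSubgroup V)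
    [DiscreteTopology G] (R : ℝ) : {g | g ∈ G ∧ ‖g‖ ≤ R}.Finite := by
  have := Metric.finite_isBounded_inter_isClosed (s := (G : Set V)) (K := Metric.closedBall 0 R)
    DiscreteTopology.isDiscrete Metric.isBounded_closedBall AddSubgroup.isClosed_of_discrete
  refine this.subset fun g hg => ⟨?_, hg.1⟩
  simpa using hg.2

/-- The elements of norm at most `R` of a discrete subgroup. -/
def AddSubgroup.normBall [ProperSpace V] (G : AddSubgroup V) [DiscreteTopology G] (R : ℝ) :
    Finset V := (G.finite_inter_closedBall R).toFinset

theorem AddSubgroup.mem_normBall [ProperSpace V] {G : AddSubgroup V} [DiscreteTopology G] {R : ℝ}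
    {g : V} : g ∈ G.normBall R ↔ g ∈ G ∧ ‖g‖ ≤ R := by
  simp [normBall]

/-- Balls of a discrete subgroup grow polynomially, by comparison of volumes. -/
theorem AddSubgroup.exists_card_normBall_le [NormedSpace ℝ V] [FiniteDimensional ℝ V]
    [ProperSpace V] (G : AddSubgroup V) [DiscreteTopology G] :
    ∃ r > 0, ∀ R ≥ 0, ((G.normBall R).card : ℝ) * r ^ Module.finrank ℝ V ≤
      (R + r) ^ Module.finrank ℝ V := by
  borelize V
  obtain ⟨r, hr, h⟩ := G.exists_forall_norm_lt_imp_eq_zero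
  refine ⟨r / 2, half_pos hr, fun R hR => ?_⟩
  let μ : Measure V := Measure.addHaar
  have hdisj : Set.PairwiseDisjoint (G.normBall R : Set V) fun g => Metric.ball g (r / 2) := by
    intro a ha b hb hab
    refine Metric.ball_disjoint_ball ?_
    by_contra hlt
    rw [not_le, add_halves, dist_eq_norm] at hlt
    exact hab (sub_eq_zero.1 (h _ (G.sub_mem (mem_normBall.1 ha).1 (mem_normBall.1 hb).1) hlt))
  have hsub : (⋃ g ∈ G.normBall R, Metric.ball g (r / 2)) ⊆ Metric.closedBall 0 (R + r / 2) := by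
    refine Set.iUnion₂_subset fun g hg => ?_
    refine Metric.ball_subset_closedBall.trans (Metric.closedBall_subset_closedBall' ?_)
    rw [dist_zero_right]
    linarith [(mem_normBall.1 hg).2]
  have hμ := measureReal_mono (μ := μ) hsub Metric.isBounded_closedBall.measure_lt_top.ne
  rw [measureReal_biUnion_finset hdisj fun g _ => Metric.isOpen_ball.measurableSet] at hμ
  have hb (g : V) : μ.real (Metric.ball g (r / 2)) =
      (r / 2) ^ Module.finrank ℝ V * μ.real (Metric.ball 0 1) :=
    by
    rw [measureReal_def, Measure.addHaar_ball_of_pos μ g (half_pos hr), ENNReal.toReal_mul,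
      ENNReal.toReal_ofReal (by positivity), measureReal_def]
  rw [Measure.addHaar_real_closedBall μ _ (by positivity)] at hμ
  simp only [hb, Finset.sum_const, nsmul_eq_mul] at hμ
  rw [← mul_assoc] at hμ
  refine le_of_mul_le_mul_right hμ ?_
  exact ENNReal.toReal_pos (Metric.measure_ball_pos μ _ one_pos).ne' measure_ball_lt_top.ne

/-- Discrete subgroups satisfy Følner's condition: if no ball had small boundary, then the balls
would grow exponentially. -/
theorem AddSubgroup.exists_card_convBoundary_lt [NormedSpace ℝ V] [FiniteDimensional ℝ V]
    [ProperSpace V] (G : AddSubgroup V) [DiscreteTopology G] (S : Finset V) (hS : ∀ s ∈ S, s ∈ G)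
    {δ : ℝ} (hδ : 0 < δ) :
    ∃ B : Finset V, (∀ b ∈ B, b ∈ G) ∧ ((convBoundary S B).card : ℝ) < δ * B.card := by
  by_contra! hcon
  obtain ⟨R, hR, hSR⟩ : ∃ R > 0, ∀ s ∈ S, ‖s‖ ≤ R := by
    refine ⟨1 + ∑ s ∈ S, ‖s‖, by positivity, fun s hs => ?_⟩
    linarith [Finset.single_le_sum (f := fun s => ‖s‖) (fun i _ => norm_nonneg i) hs]
  have hstep (t : ℝ) : (1 + δ) * ((G.normBall t).card : ℝ) ≤ (G.normBall (t + 2 * R)).card := by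
    have hmono : G.normBall t ⊆ G.normBall (t + R) := fun g hg =>
      mem_normBall.2 ⟨(mem_normBall.1 hg).1, by linarith [(mem_normBall.1 hg).2]⟩
    have hunion : Disjoint (G.normBall t) (convBoundary S (G.normBall (t + R))) := by
      rw [Finset.disjoint_left]
      intro g hg hg'
      obtain ⟨s, hs, hgs⟩ := (mem_convBoundary.1 hg').2
      refine hgs (mem_normBall.2 ⟨G.sub_mem (mem_normBall.1 hg).1 (hS s hs), ?_⟩)
      linarith [norm_sub_le g s, hSR s hs, (mem_normBall.1 hg).2]
    have hsub : (G.normBall t).disjUnion _ hunion ⊆ G.normBall (t + 2 * R) := by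
      intro g hg
      rcases Finset.mem_disjUnion.1 hg with hg | hg
      · exact mem_normBall.2 ⟨(mem_normBall.1 hg).1, by linarith [(mem_normBall.1 hg).2]⟩
      · obtain ⟨b, hb, s, hs, rfl⟩ := (mem_convBoundary.1 hg).1
        refine mem_normBall.2 ⟨G.add_mem (mem_normBall.1 hb).1 (hS s hs), ?_⟩
        linarith [norm_add_le b s, hSR s hs, (mem_normBall.1 hb).2]
    have hcard := Finset.card_le_card hsub
    rw [Finset.card_disjUnion] at hcard
    have h1 := hcon (G.normBall (t + R)) fun b hb => (mem_normBall.1 hb).1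
    have h2 : ((G.normBall t).card : ℝ) ≤ (G.normBall (t + R)).card := by
      exact_mod_cast Finset.card_le_card hmono
    have h3 : ((G.normBall t).card : ℝ) + (convBoundary S (G.normBall (t + R))).card ≤
        (G.normBall (t + 2 * R)).card := by exact_mod_cast hcard
    nlinarith
  have hexp (m : ℕ) : (1 + δ) ^ m ≤ ((G.normBall (m * (2 * R))).card : ℝ) := by
    induction m with
    | zero =>
      have : (0 : V) ∈ G.normBall ((0 : ℕ) * (2 * R)) := mem_normBall.2 ⟨G.zero_mem, by simp⟩
      rw [pow_zero]
      exact_mod_cast Finset.card_pos.2 ⟨0, this⟩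
    | succ m ih =>
      have := hstep (m * (2 * R))
      rw [pow_succ', Nat.cast_succ, add_mul (m : ℝ), one_mul]
      exact (mul_le_mul_of_nonneg_left ih (by positivity)).trans this
  obtain ⟨r, hr, hpoly⟩ := G.exists_card_normBall_le
  set d := Module.finrank ℝ V
  -- the resulting bound `(1 + δ) ^ m ≤ C (m + 1) ^ d` fails for large `m`
  have hbound (m : ℕ) : (1 + δ) ^ m * r ^ d ≤ (2 * R + r) ^ d * ((m : ℝ) + 1) ^ d := by
    rw [← mul_pow]
    calc (1 + δ) ^ m * r ^ d ≤ (G.normBall (m * (2 * R))).card * r ^ d := by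
          gcongr
          exact hexp m
      _ ≤ (m * (2 * R) + r) ^ d := hpoly _ (by positivity)
      _ ≤ _ := by
        gcongr
        nlinarith [mul_nonneg (Nat.cast_nonneg (α := ℝ) m) hr.le]
  have hlim := tendsto_pow_const_div_const_pow_of_one_lt d (r := 1 + δ) (by linarith)
  have hlim' := (hlim.comp (Filter.tendsto_add_atTop_nat 1)).eventually
    (gt_mem_nhds (show (0 : ℝ) < r ^ d / ((2 * R + r) ^ d * (1 + δ)) by positivity))
  obtain ⟨m, hm⟩ := hlim'.exists
  simp only [Function.comp_apply, Nat.cast_add, Nat.cast_one] at hm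
  rw [div_lt_div_iff₀ (by positivity) (by positivity), pow_succ] at hm
  have h1 := hbound m
  have h2 : 0 < 1 + δ := by positivity
  nlinarith

end Growth

/-! ### Plancherel's formula on `L¹ ∩ L²` -/

section Plancherel

open FourierTransform

variable {E : Type*} [NormedAddCommGroup E] [InnerProductSpace ℝ E] [FiniteDimensional ℝ E]
  [MeasurableSpace E] [BorelSpace E]

theorem continuous_fourier_of_integrable {h : E → ℂ} (hh : Integrable h) : Continuous (𝓕 h) :=
  VectorFourier.fourierIntegral_continuous Real.continuous_fourierChar
    (innerSL ℝ).continuous₂ hh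

/-- On `L¹ ∩ L²` the Fourier transform of `L²` is given by the Fourier integral, because the two
agree as tempered distributions. -/
theorem coeFn_fourier_toLp {h : E → ℂ} (h1 : Integrable h) (h2 : MemLp h 2) :
    (𝓕 (h2.toLp h) : Lp ℂ 2 (volume : Measure E)) =ᵐ[volume] 𝓕 h := by
  refine ae_eq_of_integral_contDiff_smul_eq
    ((Lp.memLp (𝓕 (h2.toLp h))).locallyIntegrable one_le_two)
    (continuous_fourier_of_integrable h1).locallyIntegrable fun g hg hgc => ?_
  have hc : HasCompactSupport (Complex.ofRealCLM ∘ g) := hgc.comp_left rfl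
  have hd : ContDiff ℝ (↑(⊤ : ℕ∞)) (Complex.ofRealCLM ∘ g) := by fun_prop
  let G := hc.toSchwartzMap hd
  have key := congrArg (fun T => T G) (Lp.fourier_toTemperedDistribution_eq (h2.toLp h))
  simp only [TemperedDistribution.fourier_apply, Lp.toTemperedDistribution_apply] at key
  have hG (x : E) (z : ℂ) : g x • z = G x • z := by
    simp [G]
  simp only [hG]
  rw [← key]
  have h3 : ∫ x, (𝓕 G) x • h2.toLp h x = ∫ x, 𝓕 (G : E → ℂ) x • h x := by
    refine integral_congr_ae ?_
    filter_upwards [h2.coeFn_toLp] with x hx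
    rw [hx, SchwartzMap.fourier_coe]
  rw [h3]
  have h4 := VectorFourier.integral_fourierIntegral_smul_eq_flip (L := innerₗ E)
    Real.continuous_fourierChar continuous_inner G.integrable (μ := volume) (ν := volume) h1
  rwa [flip_innerₗ] at h4

theorem eLpNorm_two_sq {α F : Type*} {m : MeasurableSpace α} {μ : Measure α}
    [NormedAddCommGroup F] (f : α → F) : eLpNorm f 2 μ ^ 2 = ∫⁻ x, ‖f x‖ₑ ^ 2 ∂μ := by
  have := eLpNorm_nnreal_pow_eq_lintegral (f := f) (μ := μ) (two_ne_zero : (2 : NNReal) ≠ 0)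
  norm_num at this
  exact_mod_cast this

/-- Plancherel's formula for functions in `L¹ ∩ L²`. -/
theorem lintegral_enorm_fourier_sq {h : E → ℂ} (h1 : Integrable h) (h2 : MemLp h 2) :
    ∫⁻ y, ‖𝓕 h y‖ₑ ^ 2 = ∫⁻ t, ‖h t‖ₑ ^ 2 := by
  rw [← eLpNorm_two_sq, ← eLpNorm_two_sq, ← eLpNorm_congr_ae (coeFn_fourier_toLp h1 h2),
    ← Lp.enorm_def, ← eLpNorm_congr_ae h2.coeFn_toLp, ← Lp.enorm_def, ← ofReal_norm, ← ofReal_norm,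
    Lp.norm_fourier_eq]

end Plancherel

/-! ### The short-time Fourier transform -/

section STFT

open FourierTransform

variable {n : ℕ}

/-- The coefficient `⟪ḡ φ, f⟫` at `g = (x, y)` is the value at `y` of the Fourier transform of
`t ↦ f(t) φ(t + x)*`. -/
theorem inner_timeFreqShift_eq_fourier {φ : EuclideanSpace ℝ (Fin n) → ℂ} (hφ : MemLp φ 2)
    (f : L2Space n) (g : TFGroup n) :
    inner ℂ (timeFreqShift g (hφ.toLp φ)) f =
      𝓕 (fun t => f t * (starRingEnd ℂ) (φ (t + g.1))) g.2 := by
  rw [L2.inner_def, Real.fourier_eq']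
  refine integral_congr_ae ?_
  have h := (measurePreserving_add_right volume g.1).quasiMeasurePreserving.ae_eq_comp
    hφ.coeFn_toLp
  filter_upwards [coeFn_timeFreqShift g (hφ.toLp φ), h] with t h1 h2
  simp only [Function.comp_apply] at h2
  rw [h1, h2, RCLike.inner_apply, map_mul, smul_eq_mul, phase, ← Complex.exp_conj]
  simp only [map_mul, Complex.conj_ofReal, Complex.conj_I, map_ofNat]
  rw [real_inner_comm g.2 t]
  push_cast
  rw [mul_comm, mul_right_comm, mul_comm, mul_assoc]
  ring_nf

/-- The short-time Fourier transform of `f ∈ L²(ℝⁿ)` with continuous window of compact support is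
continuous. -/
theorem continuous_inner_timeFreqShift {φ : EuclideanSpace ℝ (Fin n) → ℂ} (hφ : MemLp φ 2)
    (hc : Continuous φ) (hs : HasCompactSupport φ) (f : L2Space n) :
    Continuous fun g : TFGroup n => inner ℂ (timeFreqShift g (hφ.toLp φ)) f := by
  simp only [inner_timeFreqShift_eq_fourier, Real.fourier_eq']
  obtain ⟨C, hC⟩ := hc.bounded_above_of_compact_support hs
  obtain ⟨R, hR⟩ := hs.isCompact.isBounded.subset_closedBall 0
  refine continuous_iff_continuousAt.2 fun g₀ => ?_
  let K := Metric.closedBall (0 : EuclideanSpace ℝ (Fin n)) (R + ‖g₀.1‖ + 1)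
  have hfm : AEStronglyMeasurable f volume := Lp.aestronglyMeasurable f
  refine continuousAt_of_dominated (bound := K.indicator fun t => C * ‖f t‖) ?_ ?_ ?_ ?_
  · refine Filter.Eventually.of_forall fun g => ?_
    have h1 : Continuous fun v : EuclideanSpace ℝ (Fin n) =>
        Complex.exp (↑(-2 * Real.pi * inner ℝ v g.2) * Complex.I) := by fun_prop
    have h2 : Continuous fun v : EuclideanSpace ℝ (Fin n) => (starRingEnd ℂ) (φ (v + g.1)) :=
      Complex.continuous_conj.comp (hc.comp (by fun_prop))
    exact h1.aestronglyMeasurable.smul (hfm.mul h2.aestronglyMeasurable)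
  · filter_upwards [Metric.ball_mem_nhds g₀ one_pos] with g hg
    refine Filter.Eventually.of_forall fun t => ?_
    rw [norm_smul, Complex.norm_exp_ofReal_mul_I, one_mul, norm_mul, RCLike.norm_conj]
    by_cases ht : t ∈ K
    · rw [Set.indicator_of_mem ht, mul_comm]
      gcongr
      exact hC _
    · rw [Set.indicator_of_notMem ht]
      have : φ (t + g.1) = 0 := by
        by_contra hne
        have h1 := hR (subset_tsupport φ hne)
        rw [mem_closedBall_zero_iff] at h1
        refine ht (mem_closedBall_zero_iff.2 ?_)
        have h2 : ‖g.1 - g₀.1‖ < 1 := by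
          rw [Metric.mem_ball, dist_eq_norm] at hg
          exact (norm_fst_le (g - g₀)).trans_lt hg
        have h3 : ‖t‖ ≤ ‖t + g.1‖ + ‖g.1‖ := norm_le_add_norm_add t g.1
        have h4 : ‖g.1‖ ≤ ‖g₀.1‖ + ‖g.1 - g₀.1‖ := norm_le_norm_add_norm_sub' _ _
        linarith
      simp [this]
  · rw [integrable_indicator_iff Metric.isClosed_closedBall.measurableSet]
    have hloc : LocallyIntegrable f volume := (Lp.memLp f).locallyIntegrable one_le_two
    exact (hloc.integrableOn_isCompact (isCompact_closedBall _ _)).norm.const_mul C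
  · refine Filter.Eventually.of_forall fun t => Continuous.continuousAt ?_
    have h2 : Continuous fun g : TFGroup n => (starRingEnd ℂ) (φ (t + g.1)) :=
      Complex.continuous_conj.comp (hc.comp (by fun_prop))
    have h1 : Continuous fun g : TFGroup n =>
        Complex.exp (↑(-2 * Real.pi * inner ℝ t g.2) * Complex.I) := by fun_prop
    exact h1.smul (continuous_const.mul h2)

/-- The short-time Fourier transform is square integrable on the time-frequency plane. -/
theorem lintegral_enorm_inner_timeFreqShift_sq_lt_top {φ : EuclideanSpace ℝ (Fin n) → ℂ}
    (hφ : MemLp φ 2) (hc : Continuous φ) (hs : HasCompactSupport φ) (f : L2Space n) :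
    ∫⁻ g : TFGroup n, ‖(inner ℂ (timeFreqShift g (hφ.toLp φ)) f : ℂ)‖ₑ ^ 2 < ⊤ := by
  obtain ⟨C, hC⟩ := hc.bounded_above_of_compact_support hs
  have hcont := continuous_inner_timeFreqShift hφ hc hs f
  have hf := Lp.memLp f
  have htrans (x : EuclideanSpace ℝ (Fin n)) :
      Continuous fun t => (starRingEnd ℂ) (φ (t + x)) :=
    Complex.continuous_conj.comp (hc.comp (by fun_prop))
  have hprod : Continuous fun p : EuclideanSpace ℝ (Fin n) × EuclideanSpace ℝ (Fin n) =>
      ‖φ (p.2 + p.1)‖ₑ ^ 2 :=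
    ENNReal.continuous_pow 2 |>.comp (hc.comp (by fun_prop)).enorm
  have hx (x : EuclideanSpace ℝ (Fin n)) :
      ∫⁻ y, ‖(inner ℂ (timeFreqShift (x, y) (hφ.toLp φ)) f : ℂ)‖ₑ ^ 2 =
        ∫⁻ t, ‖f t‖ₑ ^ 2 * ‖φ (t + x)‖ₑ ^ 2 := by
    have h2 : MemLp (fun t => (starRingEnd ℂ) (φ (t + x))) 2 :=
      (hφ.comp_measurePreserving (measurePreserving_add_right volume x)).star
    have hbd : MemLp (fun t => (starRingEnd ℂ) (φ (t + x))) ⊤ :=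
      memLp_top_of_bound (htrans x).aestronglyMeasurable C
        (Filter.Eventually.of_forall fun t => by simpa using hC (t + x))
    simp only [inner_timeFreqShift_eq_fourier]
    rw [lintegral_enorm_fourier_sq (h := fun t => f t * (starRingEnd ℂ) (φ (t + x)))
      (hf.integrable_mul h2) (hbd.mul hf)]
    refine lintegral_congr fun t => ?_
    rw [enorm_mul, mul_pow, RCLike.enorm_conj]
  rw [Measure.volume_eq_prod, lintegral_prod _ (by
    exact (ENNReal.continuous_pow 2 |>.comp hcont.enorm).measurable.aemeasurable)]
  simp only [hx]
  rw [lintegral_lintegral_swap]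
  · have ht (t : EuclideanSpace ℝ (Fin n)) : ∫⁻ x, ‖f t‖ₑ ^ 2 * ‖φ (t + x)‖ₑ ^ 2 =
        ‖f t‖ₑ ^ 2 * ∫⁻ x, ‖φ x‖ₑ ^ 2 := by
      have hm : Continuous fun x => ‖φ (t + x)‖ₑ ^ 2 :=
        ENNReal.continuous_pow 2 |>.comp (hc.comp (continuous_const.add continuous_id)).enorm
      rw [lintegral_const_mul _ hm.measurable]
      congr 1
      exact lintegral_add_left_eq_self (fun x => ‖φ x‖ₑ ^ 2) t
    simp only [ht]
    rw [lintegral_mul_const'' _ (hf.1.enorm.pow_const 2), ← eLpNorm_two_sq, ← eLpNorm_two_sq]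
    exact ENNReal.mul_lt_top (ENNReal.pow_lt_top hf.2) (ENNReal.pow_lt_top hφ.2)
  · exact ((hf.1.enorm.pow_const 2).comp_snd).mul hprod.measurable.aemeasurable

end STFT

/-! ### Windows with square summable coefficients -/

section Window

variable {n : ℕ}

/-- If a nonnegative function has finite integral, then for almost every `z` near `0` its sum over
the coset `z + G` of a discrete subgroup is finite: translates of a small ball by the elements
of `G` are disjoint. -/
theorem AddSubgroup.exists_ae_ball_tsum_lt_top {V : Type*} [NormedAddCommGroup V]
    [SecondCountableTopology V] [MeasurableSpace V] [BorelSpace V] (μ : Measure V)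
    [μ.IsAddRightInvariant] (G : AddSubgroup V) [DiscreteTopology G] {F : V → ENNReal}
    (hF : Measurable F) (hint : ∫⁻ z, F z ∂μ < ⊤) :
    ∃ r > 0, ∀ᵐ z ∂μ.restrict (Metric.ball 0 r), ∑' g : G, F (g + z) < ⊤ := by
  obtain ⟨r, hr, h⟩ := G.exists_forall_norm_lt_imp_eq_zero
  have : Countable G := TopologicalSpace.separableSpace_iff_countable.1 inferInstance
  refine ⟨r / 2, half_pos hr, ae_lt_top ?_ ?_⟩
  · exact Measurable.tsum fun g => hF.comp (measurable_const_add _)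
  have hdisj : Pairwise (Function.onFun Disjoint fun g : G => Metric.ball (g : V) (r / 2)) := by
    intro a b hab
    refine Metric.ball_disjoint_ball ?_
    by_contra hlt
    rw [not_le, add_halves, dist_eq_norm] at hlt
    exact hab (Subtype.ext (sub_eq_zero.1 (h _ (G.sub_mem a.2 b.2) hlt)))
  rw [lintegral_tsum (f := fun (g : G) z => F (g + z))
    fun g => (hF.comp (measurable_const_add _)).aemeasurable]
  have htr (g : G) : ∫⁻ z in Metric.ball 0 (r / 2), F (g + z) ∂μ =
      ∫⁻ z in Metric.ball (g : V) (r / 2), F z ∂μ := by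
    rw [← lintegral_indicator Metric.isOpen_ball.measurableSet,
      ← lintegral_indicator Metric.isOpen_ball.measurableSet,
      ← lintegral_add_right_eq_self ((Metric.ball (g : V) (r / 2)).indicator F) (g : V)]
    refine lintegral_congr fun z => ?_
    simp only [Set.indicator, Metric.mem_ball, dist_eq_norm, add_comm z, add_sub_cancel_left,
      sub_zero]
  simp only [htr]
  rw [← lintegral_iUnion (fun g => Metric.isOpen_ball.measurableSet) hdisj]
  exact ((setLIntegral_le_lintegral _ _).trans_lt hint).ne

theorem exists_continuous_inner_ne_zero {f : L2Space n} (hf : f ≠ 0) :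
    ∃ (φ : EuclideanSpace ℝ (Fin n) → ℂ) (hφ : MemLp φ 2), Continuous φ ∧ HasCompactSupport φ ∧
      (inner ℂ (hφ.toLp φ) f : ℂ) ≠ 0 := by
  have hpos : 0 < ‖f‖ / 2 := half_pos (norm_pos_iff.2 hf)
  obtain ⟨φ, hs, hle, hc, hφ⟩ := (Lp.memLp f).exists_hasCompactSupport_eLpNorm_sub_le
    ENNReal.ofNat_ne_top (ENNReal.ofReal_pos.2 hpos).ne'
  refine ⟨φ, hφ, hc, hs, fun h0 => ?_⟩
  have hd : ‖f - hφ.toLp φ‖ ≤ ‖f‖ / 2 := by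
    have : f - hφ.toLp φ = ((Lp.memLp f).sub hφ).toLp _ := by
      rw [MemLp.toLp_sub (Lp.memLp f) hφ, Lp.toLp_coeFn]
    rw [this, Lp.norm_toLp]
    exact ENNReal.toReal_le_of_le_ofReal hpos.le hle
  have h1 : (inner ℂ (f - hφ.toLp φ) f : ℂ) = (‖f‖ : ℂ) ^ 2 := by
    rw [inner_sub_left, h0, sub_zero, inner_self_eq_norm_sq_to_K]
    rfl
  have h2 := norm_inner_le_norm (𝕜 := ℂ) (f - hφ.toLp φ) f
  rw [h1, norm_pow, Complex.norm_real, norm_norm] at h2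
  nlinarith

/-- For discrete `G` and `f ≠ 0` some window `ψ` not orthogonal to `f` has coefficients `⟪ḡ ψ, f⟫`
that are square summable over `G`. -/
theorem exists_window (G : AddSubgroup (TFGroup n)) [DiscreteTopology G] {f : L2Space n}
    (hf : f ≠ 0) :
    ∃ ψ : L2Space n, (inner ℂ ψ f : ℂ) ≠ 0 ∧
      Summable fun g : G => ‖(inner ℂ (timeFreqShift (g : TFGroup n) ψ) f : ℂ)‖ ^ 2 := by
  obtain ⟨φ, hφ, hc, hs, hne⟩ := exists_continuous_inner_ne_zero hf
  have hcont := continuous_inner_timeFreqShift hφ hc hs f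
  have : (volume : Measure (TFGroup n)).IsAddRightInvariant :=
    inferInstanceAs (Measure.prod volume volume).IsAddRightInvariant
  obtain ⟨r, hr, hae⟩ := G.exists_ae_ball_tsum_lt_top volume
    (ENNReal.continuous_pow 2 |>.comp hcont.enorm).measurable
    (lintegral_enorm_inner_timeFreqShift_sq_lt_top hφ hc hs f)
  -- the coefficient at `z` does not vanish for `z` near `0`, so some `z` has both properties
  let U : Set (TFGroup n) := {z | (inner ℂ (timeFreqShift z (hφ.toLp φ)) f : ℂ) ≠ 0}
  have hU : IsOpen U := isOpen_ne_fun hcont continuous_const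
  have h0U : (0 : TFGroup n) ∈ U := by
    simpa [U, timeFreqShift_zero] using hne
  have hpos : 0 < volume (U ∩ Metric.ball 0 r) :=
    (hU.inter Metric.isOpen_ball).measure_pos _ ⟨0, h0U, Metric.mem_ball_self hr⟩
  rw [ae_restrict_iff' Metric.isOpen_ball.measurableSet] at hae
  obtain ⟨z, ⟨hzU, hzr⟩, hz⟩ : ∃ z ∈ U ∩ Metric.ball 0 r, z ∈ Metric.ball 0 r →
      ∑' g : G, ‖(inner ℂ (timeFreqShift ((g : TFGroup n) + z) (hφ.toLp φ)) f : ℂ)‖ₑ ^ 2 < ⊤ :=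
    (frequently_ae_mem_iff.2 hpos.ne').and_eventually hae |>.exists
  refine ⟨timeFreqShift z (hφ.toLp φ), hzU, ?_⟩
  refine (ENNReal.summable_toReal (hz hzr).ne).congr fun g => ?_
  rw [timeFreqShift_timeFreqShift, inner_smul_left, norm_mul, RCLike.norm_conj, norm_phase,
    one_mul, ENNReal.toReal_pow, toReal_enorm]

end Window

end

theorem theorem1p2 (n : ℕ) (hn : 0 < n) (G : AddSubgroup (TFGroup n)) (hG : DiscreteTopology G)
    (θ : TwistedGroupRing n) (hθG : θ ∈ TwistedGroupRing.subgroupAlgebra G) (hθ : θ ≠ 0)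
    (f : L2Space n) (hf : f ≠ 0) :
    twistedAction n θ f ≠ 0 := by
  intro h0
  obtain ⟨ψ, hψ, hsum⟩ := exists_window G hf
  set M := ∑' g : G, ‖(inner ℂ (timeFreqShift (g : TFGroup n) ψ) f : ℂ)‖ ^ 2
  have hnorm (k h : TFGroup n) :
      ‖(inner ℂ (timeFreqShift h (timeFreqShift (-k) ψ)) f : ℂ)‖ =
        ‖(inner ℂ (timeFreqShift (h - k) ψ) f : ℂ)‖ := by
    rw [timeFreqShift_timeFreqShift, inner_smul_left, norm_mul, RCLike.norm_conj, norm_phase,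
      one_mul, sub_eq_add_neg]
  have hc : 0 < ‖(inner ℂ ψ f : ℂ)‖ ^ 2 := by positivity
  have hle (B : Finset (TFGroup n)) (hB : ∀ b ∈ B, b ∈ G) :
      B.card * ‖(inner ℂ ψ f : ℂ)‖ ^ 2 ≤ (convBoundary θ.support B).card * M := by
    refine TwistedGroupRing.card_mul_le_card_convBoundary_mul hθ
      (fun k h => inner ℂ (timeFreqShift h (timeFreqShift (-k) ψ)) f) (fun k h => ?_) B
      (fun b _ => ?_) fun b hb => ?_
    · rw [← inner_timeFreqShift_twistedAction, h0, inner_zero_right]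
    · rw [hnorm, sub_self, timeFreqShift_zero, one_apply_eq_self]
    · let e : B ↪ G := ⟨fun h => ⟨h.1 - b, G.sub_mem (hB _ h.2) (hB b hb)⟩, fun h h' hh =>
        Subtype.ext (sub_left_injective (congrArg Subtype.val hh))⟩
      calc ∑ h ∈ B, ‖(inner ℂ (timeFreqShift h (timeFreqShift (-b) ψ)) f : ℂ)‖ ^ 2
          = ∑ h : B, ‖(inner ℂ (timeFreqShift (h.1 - b) ψ) f : ℂ)‖ ^ 2 := by
            simp only [hnorm]
            exact (Finset.sum_coe_sort B
              fun h => ‖(inner ℂ (timeFreqShift (h - b) ψ) f : ℂ)‖ ^ 2).symm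
        _ = ∑ g ∈ Finset.univ.map e,
              ‖(inner ℂ (timeFreqShift (g : TFGroup n) ψ) f : ℂ)‖ ^ 2 := by
            rw [Finset.sum_map]
            rfl
        _ ≤ M := hsum.sum_le_tsum _ fun _ _ => by positivity
  have hM : 0 < M := by
    refine hsum.tsum_pos (fun _ => by positivity) (0 : G) ?_
    rw [AddSubgroup.coe_zero, timeFreqShift_zero]
    exact hc
  obtain ⟨B, hB, hlt⟩ := G.exists_card_convBoundary_lt θ.support
    (fun g hg => TwistedGroupRing.support_subset_of_mem_subgroupAlgebra hθG hg) (div_pos hc hM)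
  have h1 := hle B hB
  rw [div_mul_eq_mul_div, lt_div_iff₀ hM] at hlt
  linarith
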